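/- Let $(X,d)$ be a path-connected metric space that is homeomorphic to an inverse limit $\varprojlim_{j\in\mathbb N}(X_j,r_{j+1,j})$ of a sequence of finite polyhedra $X_j$ (spaces homeomorphic to the underlying space of a finite simplicial complex), where every bonding map $r_{j+1,j}:X_{j+1}\to X_j$ is a retraction, i.e. a continuous map having a continuous section $s_{j,j+1}:X_j\to X_{j+1}$, $r_{j+1,j}\circ s_{j,j+1}=\mathrm{id}_{X_j}$. Then for every $n\ge 1$ and every $x_0\in X$, the shape topology on $\pi_n(X,x_0)$ is at least as fine as the pseudometric topology induced by $d$. Here the two topologies are defined as follows. Pseudometric topology: it is the topology induced by the pseudometric $$\rho(a,b)=\inf\Big\{\sup_{t\in[0,1]^n}d(\alpha(t),\beta(t))\ :\ \alpha\in a,\ \beta\in b\Big\},\qquad a,b\in\pi_n(X,x_0),$$ where $\alpha,\beta$ range over the $n$-loops $([0,1]^n,\partial[0,1]^n)\to(X,x_0)$ representing $a$ and $b$. Shape topology: consider the pairs $(\mathscr U,U_0)$ where $\mathscr U$ is a locally finite open cover of $X$ and $U_0\in\mathscr U$ contains $x_0$, directed by refinement. Let $|N(\mathscr U)|$ be the geometric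 realization of the nerve of $\mathscr U$, let $p_{\mathscr U}:X\to|N(\mathscr U)|$ be the map whose barycentric coordinates are the functions of a partition of unity $\{\phi_U\}_{U\in\mathscr U}$ subordinated to $\mathscr U$ with $\phi_{U_0}(x_0)=1$, and, when $(\mathscr V,V_0)$ refines $(\mathscr U,U_0)$, let $p_{\mathscr U\mathscr V}:|N(\mathscr V)|\to|N(\mathscr U)|$ be a simplicial map sending each vertex $V$ to a vertex $U\supseteq V$, and $V_0$ to $U_0$. The $n$-th shape homotopy group is the inverse limit $\check\pi_n(X,x_0)=\varprojlim\big(\pi_n(|N(\mathscr U)|,U_0),\,p_{\mathscr U\mathscr V\#}\big)$ of discrete groups, with the inverse limit topology, and the shape topology on $\pi_n(X,x_0)$ is the initial topology with respect to $\Psi_n:\pi_n(X,x_0)\to\check\pi_n(X,x_0)$, $\Psi_n([\alpha])=([p_{\mathscr U}\circ\alpha])_{\mathscr U}$. -/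

import Mathlib

open scoped unitInterval Topology Topology.Homotopy

noncomputable section

/-! ## Finite polyhedra, retractions and inverse limits of sequences -/

/-- A finite polyhedron: a space homeomorphic to the underlying space of a finite simplicial
complex (every finite complex can be realized in some Euclidean space). -/
def IsFinitePolyhedron (Y : Type*) [TopologicalSpace Y] : Prop :=
  ∃ (N : ℕ) (K : Geometry.SimplicialComplex ℝ (EuclideanSpace ℝ (Fin N))),
    K.faces.Finite ∧ Nonempty (Y ≃ₜ K.space)

/-- A map `r : Y → Z` is a retraction if it has a continuous section. The section is then
automatically an embedding of `Z` as a retract of `Y`. -/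
def IsRetractionMap {Y Z : Type*} [TopologicalSpace Y] [TopologicalSpace Z] (r : C(Y, Z)) : Prop :=
  ∃ s : C(Z, Y), r.comp s = ContinuousMap.id Z

/-- The inverse limit of the sequence `⋯ → Y 2 → Y 1 → Y 0`, a subspace of the product. -/
def SequentialLimit {Y : ℕ → Type*} [∀ j, TopologicalSpace (Y j)]
    (r : ∀ j, C(Y (j + 1), Y j)) : Type _ :=
  {y : ∀ j, Y j // ∀ j, r j (y (j + 1)) = y j}

instance {Y : ℕ → Type*} [∀ j, TopologicalSpace (Y j)] (r : ∀ j, C(Y (j + 1), Y j)) :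
    TopologicalSpace (SequentialLimit r) :=
  inferInstanceAs (TopologicalSpace {y : ∀ j, Y j // ∀ j, r j (y (j + 1)) = y j})

/-! ## The pseudometric topology on homotopy groups -/

section Pseudometric

variable {X : Type*} [MetricSpace X] {x₀ : X}

/-- The uniform metric on the space of `n`-loops. -/
def uniformDist {n : ℕ} (α β : Ω^ (Fin n) X x₀) : ℝ :=
  ⨆ t : I^ (Fin n), dist (α t) (β t)

/-- The pseudometric `ρ` on `π_n(X, x₀)`: the infimum of the uniform distances between
representatives. -/
def homotopyPseudodist {n : ℕ} (a b : π_ n X x₀) : ℝ :=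
  sInf {d : ℝ | ∃ α β : Ω^ (Fin n) X x₀,
    (Quotient.mk _ α : π_ n X x₀) = a ∧ (Quotient.mk _ β : π_ n X x₀) = b ∧
      d = uniformDist α β}

/-- The topology on `π_n(X, x₀)` induced by the pseudometric `ρ`: a set is open iff it contains
a `ρ`-ball around each of its points. -/
@[reducible] def pseudometricTopology (n : ℕ) (x₀ : X) : TopologicalSpace (π_ n X x₀) where
  IsOpen A := ∀ a ∈ A, ∃ ε > 0, ∀ b, homotopyPseudodist a b < ε → b ∈ A
  isOpen_univ := fun _ _ => ⟨1, one_pos, fun _ _ => trivial⟩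
  isOpen_inter := fun A B hA hB a ha => by
    obtain ⟨ε, hε, h⟩ := hA a ha.1
    obtain ⟨δ, hδ, h'⟩ := hB a ha.2
    exact ⟨min ε δ, lt_min hε hδ, fun b hb =>
      ⟨h b (hb.trans_le (min_le_left _ _)), h' b (hb.trans_le (min_le_right _ _))⟩⟩
  isOpen_sUnion := fun S hS a ⟨A, hA, ha⟩ => by
    obtain ⟨ε, hε, h⟩ := hS A hA a ha
    exact ⟨ε, hε, fun b hb => ⟨A, hA, h b hb⟩⟩

end Pseudometric

/-! ## Induced maps on homotopy groups -/

section InducedMap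

variable {X Y Z : Type*} [TopologicalSpace X] [TopologicalSpace Y] [TopologicalSpace Z]

/-- Composition of an `n`-loop with a based map. -/
def loopComp {n : ℕ} (f : C(X, Y)) {x : X} {y : Y} (h : f x = y) (α : Ω^ (Fin n) X x) :
    Ω^ (Fin n) Y y :=
  ⟨f.comp α.1, fun t ht => by
    have : α.1 t = x := α.2 t ht
    simp [this, h]⟩

/-- The map `f_# : π_n(X, x) → π_n(Y, y)` induced by a based map `f : (X, x) → (Y, y)`. -/
def homotopyGroupMap (n : ℕ) (f : C(X, Y)) {x : X} {y : Y} (h : f x = y) :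
    π_ n X x → π_ n Y y :=
  Quotient.map (loopComp f h) fun _ _ hαβ => ContinuousMap.HomotopicRel.comp_continuousMap hαβ f

theorem homotopyGroupMap_comp (n : ℕ) (f : C(X, Y)) (g : C(Y, Z)) {x : X} {y : Y} {z : Z}
    (hf : f x = y) (hg : g y = z) (hgf : (g.comp f) x = z) (a : π_ n X x) :
    homotopyGroupMap n g hg (homotopyGroupMap n f hf a) =
      homotopyGroupMap n (g.comp f) hgf a := by
  induction a using Quotient.inductionOn with
  | h α => rfl

theorem homotopyGroupMap_congr (n : ℕ) {f g : C(X, Y)} {x : X} {y : Y}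
    (hf : f x = y) (hg : g x = y) (H : f.HomotopicRel g {x}) (a : π_ n X x) :
    homotopyGroupMap n f hf a = homotopyGroupMap n g hg a := by
  induction a using Quotient.inductionOn with
  | h α =>
    refine Quotient.sound ?_
    obtain ⟨F⟩ := H
    refine ⟨⟨⟨⟨fun p => F (p.1, α p.2), by
      have : Continuous α := α.1.continuous
      fun_prop⟩, fun t => ?_, fun t => ?_⟩, fun s t ht => ?_⟩⟩
    · simp [loopComp]
    · simp [loopComp]
    · have hα : α t = x := α.2 t ht
      have := F.prop s x rfl
      simpa [loopComp, hα] using this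

end InducedMap

/-! ## Geometric realization of abstract simplicial complexes -/

namespace PreAbstractSimplicialComplex

variable {V W : Type*}

/-- The closed simplex with vertex set `s`, in barycentric coordinates. It carries the
topology of pointwise convergence of coordinates, which is its Euclidean topology. -/
def closedSimplex (s : Finset V) : Set (V → ℝ) :=
  {f | Function.support f ⊆ s ∧ (∀ v, 0 ≤ f v) ∧ ∑ᶠ v, f v = 1}

/-- The points of the geometric realization of `K`, in barycentric coordinates. -/
def Realization (K : PreAbstractSimplicialComplex V) : Type _ :=
  {f : V → ℝ // ∃ s ∈ K.faces, f ∈ closedSimplex s}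

namespace Realization

variable {K : PreAbstractSimplicialComplex V} {L : PreAbstractSimplicialComplex W}

/-- The inclusion of a closed simplex into the realization. -/
def incl (K : PreAbstractSimplicialComplex V) (s : K.faces) (f : closedSimplex (s : Finset V)) :
    K.Realization :=
  ⟨f.1, s.1, s.2, f.2⟩

/-- The weak topology: the finest topology for which all inclusions of closed simplices are
continuous. -/
instance : TopologicalSpace K.Realization :=
  ⨆ s : K.faces, TopologicalSpace.coinduced (incl K s) inferInstance

theorem continuous_incl (s : K.faces) : Continuous (incl K s) :=
  continuous_iSup_rng (i := s) continuous_coinduced_rng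

/-- A map into the realization with continuous, locally finite barycentric coordinates is
continuous for the weak topology. -/
theorem continuous_of_coord {Z : Type*} [TopologicalSpace Z] (F : Z → K.Realization)
    (hc : ∀ v, Continuous fun z => (F z).1 v)
    (hf : LocallyFinite fun v => Function.support fun z => (F z).1 v) : Continuous F := by
  classical
  rw [continuous_iff_continuousAt]
  intro z
  obtain ⟨O, hO, hfin⟩ := hf z
  let T : Finset V := hfin.toFinset
  let J := {t : Finset V // t ∈ T.powerset ∧ t ∈ K.faces}
  have : Finite J :=
    Finite.of_injective (fun t : J => (⟨t.1, t.2.1⟩ : T.powerset)) fun a b h =>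
      Subtype.ext (congrArg (fun u => u.1) h)
  let A : J → Set Z := fun t => {z | ∀ v ∉ t.1, (F z).1 v = 0}
  have hA : ∀ t, IsClosed (A t) := fun t => by
    have : A t = ⋂ v, ⋂ (_ : v ∉ t.1), {z | (F z).1 v = 0} := by
      ext z; simp [A]
    rw [this]
    exact isClosed_iInter fun v => isClosed_iInter fun _ =>
      isClosed_eq (hc v) continuous_const
  have hAF : ∀ t, ContinuousOn F (A t) := fun t => by
    rw [continuousOn_iff_continuous_domRestrict]
    have hmem : ∀ w : A t, (F w).1 ∈ closedSimplex t.1 := fun w => by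
      obtain ⟨s, _, _, h2, h3⟩ := (F w).2
      refine ⟨fun v hv => ?_, h2, h3⟩
      by_contra hvt
      exact hv (w.2 v hvt)
    have : (A t).domRestrict F = incl K ⟨t.1, t.2.2⟩ ∘ fun w : A t => ⟨(F w).1, hmem w⟩ := rfl
    rw [this]
    refine (continuous_incl _).comp (Continuous.subtype_mk ?_ _)
    exact continuous_pi fun v => (hc v).comp continuous_subtype_val
  have hU : ContinuousOn F (⋃ t, A t) :=
    (locallyFinite_of_finite A).continuousOn_iUnion hA hAF
  refine hU.continuousAt (Filter.mem_of_superset hO fun w hw => ?_)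
  obtain ⟨s, hs, h1, h2, h3⟩ := (F w).2
  have hsub : ∀ v, (F w).1 v ≠ 0 → v ∈ s ∧ v ∈ T := fun v hv =>
    ⟨h1 hv, hfin.mem_toFinset.2 ⟨w, hv, hw⟩⟩
  have hne : (s ∩ T).Nonempty := by
    obtain ⟨v, hv⟩ : ∃ v, (F w).1 v ≠ 0 := by
      by_contra! h
      simp [h] at h3
    exact ⟨v, Finset.mem_inter.2 (hsub v hv)⟩
  refine Set.mem_iUnion.2 ⟨⟨s ∩ T, Finset.mem_powerset.2 Finset.inter_subset_right,
    (K.isRelLowerSet_faces hs).2 Finset.inter_subset_left hne⟩, fun v hv => ?_⟩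
  by_contra h
  exact hv (Finset.mem_inter.2 (hsub v h))

/-- Two maps with continuous, locally finite barycentric coordinates that send each point into
a common closed simplex are homotopic relative to any set on which they agree. -/
theorem homotopicRel_of_coord {Z : Type*} [TopologicalSpace Z] (f g : C(Z, K.Realization))
    (hfc : ∀ v, Continuous fun z => (f z).1 v) (hgc : ∀ v, Continuous fun z => (g z).1 v)
    (hff : LocallyFinite fun v => Function.support fun z => (f z).1 v)
    (hgf : LocallyFinite fun v => Function.support fun z => (g z).1 v)
    (hfg : ∀ z, ∃ s ∈ K.faces, (f z).1 ∈ closedSimplex s ∧ (g z).1 ∈ closedSimplex s)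
    (S : Set Z) (hS : ∀ z ∈ S, f z = g z) : f.HomotopicRel g S := by
  classical
  let G : I × Z → V → ℝ := fun p v => (1 - (p.1 : ℝ)) * (f p.2).1 v + (p.1 : ℝ) * (g p.2).1 v
  have hG : ∀ p, ∃ s ∈ K.faces, G p ∈ closedSimplex s := fun p => by
    obtain ⟨s, hs, ⟨f1, f2, f3⟩, ⟨g1, g2, g3⟩⟩ := hfg p.2
    refine ⟨s, hs, ?_, fun v => ?_, ?_⟩
    · intro v hv
      by_contra hvs
      have e1 : (f p.2).1 v = 0 := by
        by_contra h; exact hvs (f1 h)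
      have e2 : (g p.2).1 v = 0 := by
        by_contra h; exact hvs (g1 h)
      exact hv (by simp [G, e1, e2])
    · have := p.1.2.1
      have := p.1.2.2
      exact add_nonneg (mul_nonneg (by linarith) (f2 v)) (mul_nonneg (by linarith) (g2 v))
    · have fs := s.finite_toSet.subset f1
      have gs := s.finite_toSet.subset g1
      change ∑ᶠ v, ((1 - (p.1 : ℝ)) * (f p.2).1 v + (p.1 : ℝ) * (g p.2).1 v) = 1
      rw [finsum_add_distrib, ← mul_finsum, ← mul_finsum, f3, g3]
      · ring
      · exact fs.subset (fun v hv => right_ne_zero_of_mul hv)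
      · exact gs.subset (fun v hv => right_ne_zero_of_mul hv)
  let H : I × Z → K.Realization := fun p => ⟨G p, hG p⟩
  have hH : Continuous H := by
    refine continuous_of_coord H (fun v => ?_) fun p => ?_
    · have h1 := (hfc v).comp (continuous_snd (X := I) (Y := Z))
      have h2 := (hgc v).comp (continuous_snd (X := I) (Y := Z))
      have h0 : Continuous fun p : I × Z => (p.1 : ℝ) :=
        continuous_subtype_val.comp continuous_fst
      exact ((continuous_const.sub h0).mul h1).add (h0.mul h2)
    · obtain ⟨O, hO, hOf⟩ := hff p.2
      obtain ⟨O', hO', hOg⟩ := hgf p.2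
      refine ⟨Prod.snd ⁻¹' (O ∩ O'), continuous_snd.continuousAt.preimage_mem_nhds
        (Filter.inter_mem hO hO'), (hOf.union hOg).subset ?_⟩
      rintro v ⟨q, hq, hqO⟩
      by_cases h : (f q.2).1 v = 0
      · refine Or.inr ⟨q.2, fun h' => hq ?_, hqO.2⟩
        simp only at h'
        simp [H, G, h, h']
      · exact Or.inl ⟨q.2, h, hqO.1⟩
  refine ⟨⟨⟨⟨H, hH⟩, fun z => ?_, fun z => ?_⟩, fun t z hz => ?_⟩⟩
  · exact Subtype.ext (funext fun v => by simp [H, G])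
  · exact Subtype.ext (funext fun v => by simp [H, G])
  · refine Subtype.ext (funext fun v => ?_)
    have := hS z hz
    change (1 - (t : ℝ)) * (f z).1 v + (t : ℝ) * (g z).1 v = (f z).1 v
    rw [← this]
    ring

/-- Linear extension of a vertex map: the `w`-th barycentric coordinate of the image is the sum
of the coordinates of the vertices sent to `w`. -/
def pushCoord (φ : V → W) (f : V → ℝ) : W → ℝ :=
  fun w => ∑ᶠ v, (φ ⁻¹' {w}).indicator f v

theorem pushCoord_eq_sum (φ : V → W) {f : V → ℝ} {s : Finset V}
    (hs : Function.support f ⊆ s) (w : W) :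
    pushCoord φ f w = ∑ v ∈ s, (φ ⁻¹' {w}).indicator f v := by
  refine finsum_eq_sum_of_support_subset _ fun v hv => hs ?_
  rw [Set.support_indicator] at hv
  exact hv.2

theorem pushCoord_mem (φ : V → W) {f : V → ℝ} {s : Finset V} {t : Finset W}
    (hst : ∀ v ∈ s, φ v ∈ t) (hf : f ∈ closedSimplex s) :
    pushCoord φ f ∈ closedSimplex t := by
  classical
  obtain ⟨h1, h2, h3⟩ := hf
  have hsupp : Function.support (pushCoord φ f) ⊆ ↑t := by
    intro w hw
    by_contra hws
    refine hw ?_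
    rw [pushCoord_eq_sum φ h1]
    refine Finset.sum_eq_zero fun v hv => Set.indicator_of_notMem ?_ _
    rintro rfl
    exact hws (hst v hv)
  refine ⟨hsupp, fun w => ?_, ?_⟩
  · rw [pushCoord_eq_sum φ h1]
    exact Finset.sum_nonneg fun v _ => Set.indicator_nonneg (fun v _ => h2 v) v
  · rw [finsum_eq_sum_of_support_subset _ hsupp]
    simp_rw [pushCoord_eq_sum φ h1]
    rw [Finset.sum_comm, ← h3, finsum_eq_sum_of_support_subset _ h1]
    refine Finset.sum_congr rfl fun v hv => ?_
    refine (Finset.sum_eq_single_of_mem (f := fun w => (φ ⁻¹' {w}).indicator f v) (φ v)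
      (hst v hv) fun w _ hw => ?_).trans ?_
    · exact Set.indicator_of_notMem (s := φ ⁻¹' {w}) (fun h : φ v = w => hw h.symm) f
    · exact Set.indicator_of_mem (s := φ ⁻¹' {φ v}) rfl f

/-- The map of realizations induced by a simplicial vertex map, that is, a map of vertices that
sends each face into a face. -/
def simplicialMap (φ : V → W) (hφ : ∀ s ∈ K.faces, ∃ t ∈ L.faces, ∀ v ∈ s, φ v ∈ t) :
    C(K.Realization, L.Realization) where
  toFun f := ⟨pushCoord φ f.1, by
    obtain ⟨s, hs, hf⟩ := f.2
    obtain ⟨t, ht, hst⟩ := hφ s hs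
    exact ⟨t, ht, pushCoord_mem φ hst hf⟩⟩
  continuous_toFun := by
    refine continuous_iSup_dom.2 fun s => continuous_coinduced_dom.2 ?_
    obtain ⟨t, ht, hst⟩ := hφ s.1 s.2
    have hm : ∀ f : closedSimplex (s : Finset V), pushCoord φ f.1 ∈ closedSimplex t :=
      fun f => pushCoord_mem φ hst f.2
    change Continuous (incl L ⟨t, ht⟩ ∘
      fun f : closedSimplex (s : Finset V) => ⟨pushCoord φ f.1, hm f⟩)
    refine (continuous_incl _).comp (Continuous.subtype_mk (continuous_pi fun w => ?_) _)
    simp_rw [fun f : closedSimplex (s : Finset V) => pushCoord_eq_sum φ f.2.1 w]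
    refine continuous_finsetSum _ fun v _ => ?_
    by_cases hv : v ∈ φ ⁻¹' {w}
    · simp_rw [Set.indicator_of_mem hv]
      exact (continuous_apply v).comp continuous_subtype_val
    · simp_rw [Set.indicator_of_notMem hv]
      exact continuous_const

/-- The point of the realization given by a vertex. -/
def vertex (K : PreAbstractSimplicialComplex V) (v : V) (hv : {v} ∈ K.faces) : K.Realization :=
  ⟨({v} : Set V).indicator 1, {v}, hv, by
    refine ⟨fun w hw => ?_, fun w => Set.indicator_nonneg (fun _ _ => zero_le_one) w, ?_⟩
    · simpa using hw
    · rw [finsum_eq_single _ v fun w hw => by simp [hw]]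
      simp⟩

end Realization

end PreAbstractSimplicialComplex

/-! ## Pointed covers, nerves and the shape topology -/

open PreAbstractSimplicialComplex

/-- A locally finite open cover `𝒰` of `X` with a distinguished member `U₀` containing `x₀`. -/
structure PointedCover {X : Type*} [TopologicalSpace X] (x₀ : X) where
  sets : Set (Set X)
  isOpen : ∀ U ∈ sets, IsOpen U
  covers : ⋃₀ sets = Set.univ
  locallyFinite : LocallyFinite fun U : sets => (U : Set X)
  base : sets
  mem_base : x₀ ∈ (base : Set X)

namespace PointedCover

variable {X : Type*} [TopologicalSpace X] {x₀ : X}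

/-- The nerve of a cover: finitely many members span a simplex iff they have a common point. -/
def nerve (𝒰 : PointedCover x₀) : PreAbstractSimplicialComplex 𝒰.sets where
  faces := {s | s.Nonempty ∧ ∃ x : X, ∀ U ∈ s, x ∈ (U : Set X)}
  isRelLowerSet_faces := by
    rintro s ⟨hs, x, hx⟩
    exact ⟨hs, fun t hts ht => ⟨ht, x, fun U hU => hx U (hts hU)⟩⟩

/-- The realization `|N(𝒰)|` of the nerve. -/
abbrev NerveSpace (𝒰 : PointedCover x₀) : Type _ := 𝒰.nerve.Realization

/-- The vertex `U₀` of `|N(𝒰)|`, used as basepoint. -/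
def basepoint (𝒰 : PointedCover x₀) : 𝒰.NerveSpace :=
  Realization.vertex 𝒰.nerve 𝒰.base ⟨by simp, x₀, by simpa using 𝒰.mem_base⟩

/-- A choice, for each `V ∈ 𝒱`, of a member of `𝒰` containing it, with `V₀` sent to `U₀`. Such a
choice exists iff `(𝒱, V₀)` refines `(𝒰, U₀)`. -/
structure Refinement (𝒱 𝒰 : PointedCover x₀) where
  toFun : 𝒱.sets → 𝒰.sets
  subset : ∀ V : 𝒱.sets, (V : Set X) ⊆ (toFun V : Set X)
  map_base : toFun 𝒱.base = 𝒰.base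

/-- The simplicial map `p_{𝒰𝒱} : |N(𝒱)| → |N(𝒰)|` of a refinement. -/
def Refinement.bonding {𝒱 𝒰 : PointedCover x₀} (q : Refinement 𝒱 𝒰) :
    C(𝒱.NerveSpace, 𝒰.NerveSpace) :=
  Realization.simplicialMap q.toFun (by
    classical
    rintro s ⟨hs, x, hx⟩
    refine ⟨s.image q.toFun, ⟨hs.image _, x, fun U hU => ?_⟩,
      fun V hV => Finset.mem_image_of_mem _ hV⟩
    obtain ⟨V, hV, rfl⟩ := Finset.mem_image.1 hU
    exact q.subset V (hx V hV))

theorem Refinement.bonding_basepoint {𝒱 𝒰 : PointedCover x₀} (q : Refinement 𝒱 𝒰) :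
    q.bonding 𝒱.basepoint = 𝒰.basepoint := by
  classical
  refine Subtype.ext (funext fun U => ?_)
  change Realization.pushCoord q.toFun (({𝒱.base} : Set 𝒱.sets).indicator 1) U =
    ({𝒰.base} : Set 𝒰.sets).indicator (1 : 𝒰.sets → ℝ) U
  unfold Realization.pushCoord
  rw [finsum_eq_single _ 𝒱.base fun w hw => by simp [hw]]
  simp [q.map_base, Set.indicator_apply, eq_comm]

/-- A partition of unity subordinate to `𝒰` with `φ_{U₀}(x₀) = 1`. -/
structure CanonicalPartition (𝒰 : PointedCover x₀) where
  φ : PartitionOfUnity 𝒰.sets X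
  subordinate : φ.IsSubordinate fun U => (U : Set X)
  base_eq_one : φ 𝒰.base x₀ = 1

theorem exists_canonicalPartition [T4Space X] (𝒰 : PointedCover x₀) :
    Nonempty 𝒰.CanonicalPartition := by
  classical
  let T : 𝒰.sets → Set X := fun U => if U = 𝒰.base then (U : Set X) else (U : Set X) \ {x₀}
  have hT : ∀ U, T U ⊆ (U : Set X) := fun U => by
    dsimp only [T]; split_ifs
    · exact subset_rfl
    · exact Set.sdiff_subset
  have hTo : ∀ U, IsOpen (T U) := fun U => by
    dsimp only [T]; split_ifs
    · exact 𝒰.isOpen _ U.2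
    · exact (𝒰.isOpen _ U.2).sdiff isClosed_singleton
  have hTc : Set.univ ⊆ ⋃ U, T U := by
    intro x _
    rw [Set.mem_iUnion]
    by_cases hx : x = x₀
    · exact ⟨𝒰.base, by simpa [T, hx] using 𝒰.mem_base⟩
    · obtain ⟨U, hU, hxU⟩ : x ∈ ⋃₀ 𝒰.sets := by rw [𝒰.covers]; trivial
      refine ⟨⟨U, hU⟩, ?_⟩
      dsimp only [T]; split_ifs
      · exact hxU
      · exact ⟨hxU, hx⟩
  obtain ⟨φ, hφ⟩ := PartitionOfUnity.exists_isSubordinate_of_locallyFinite isClosed_univ T hTo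
    (𝒰.locallyFinite.subset hT) hTc
  refine ⟨⟨φ, fun U => (hφ U).trans (hT U), ?_⟩⟩
  have h1 := φ.sum_eq_one (Set.mem_univ x₀)
  rwa [finsum_eq_single _ 𝒰.base fun U hU => ?_] at h1
  by_contra h
  have : x₀ ∈ T U := hφ U (subset_tsupport _ h)
  simp [T, hU] at this

theorem CanonicalPartition.mem_closedSimplex {𝒰 : PointedCover x₀} (P : 𝒰.CanonicalPartition)
    (x : X) : ∃ s : Finset 𝒰.sets, (∀ U ∈ s, x ∈ (U : Set X)) ∧
      (fun U => P.φ U x) ∈ closedSimplex s := by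
  refine ⟨P.φ.finsupport x, fun U hU => ?_, ?_, fun U => P.φ.nonneg U x,
    P.φ.sum_eq_one (Set.mem_univ x)⟩
  · have := (P.φ.mem_finsupport x).1 hU
    exact P.subordinate U (subset_tsupport _ this)
  · rw [P.φ.coe_finsupport x]

theorem nonempty_of_mem_closedSimplex {V : Type*} {s : Finset V} {f : V → ℝ}
    (hf : f ∈ closedSimplex s) : s.Nonempty := by
  rw [Finset.nonempty_iff_ne_empty]
  rintro rfl
  have h0 : ∀ v, f v = 0 := fun v => by
    by_contra h
    exact absurd (hf.1 h) (by simp)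
  have := hf.2.2
  simp [h0] at this

/-- The canonical map `p_𝒰 : X → |N(𝒰)|`, whose barycentric coordinates are the functions of the
partition of unity. -/
def CanonicalPartition.map {𝒰 : PointedCover x₀} (P : 𝒰.CanonicalPartition) :
    C(X, 𝒰.NerveSpace) where
  toFun x := ⟨fun U => P.φ U x, by
    obtain ⟨s, hs, h⟩ := P.mem_closedSimplex x
    exact ⟨s, ⟨nonempty_of_mem_closedSimplex h, x, hs⟩, h⟩⟩
  continuous_toFun := Realization.continuous_of_coord _ (fun U => (P.φ U).continuous)
    P.φ.locallyFinite

theorem CanonicalPartition.map_basepoint {𝒰 : PointedCover x₀} (P : 𝒰.CanonicalPartition) :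
    P.map x₀ = 𝒰.basepoint := by
  classical
  refine Subtype.ext (funext fun U => ?_)
  change P.φ U x₀ = ({𝒰.base} : Set 𝒰.sets).indicator (1 : 𝒰.sets → ℝ) U
  by_cases hU : U = 𝒰.base
  · subst hU; simp [P.base_eq_one]
  · rw [Set.indicator_of_notMem (by simpa using hU)]
    by_contra h
    obtain ⟨s, -, h1, h2, h3⟩ := P.mem_closedSimplex x₀
    simp only at h2 h3
    rw [finsum_eq_sum_of_support_subset _ h1] at h3
    have hb : 𝒰.base ∈ s := h1 (by simp [P.base_eq_one])
    have hUs : U ∈ s := h1 h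
    have := Finset.add_le_sum (fun i _ => h2 i) hUs hb hU
    rw [h3, P.base_eq_one] at this
    have := lt_of_le_of_ne (h2 U) (Ne.symm h)
    linarith

/-- `p_{𝒰𝒱} ∘ p_𝒱` and `p_𝒰` are homotopic relative to the basepoint. -/
theorem CanonicalPartition.bonding_comp_map {𝒱 𝒰 : PointedCover x₀} (P : 𝒱.CanonicalPartition)
    (Q : 𝒰.CanonicalPartition) (q : Refinement 𝒱 𝒰) :
    (q.bonding.comp P.map).HomotopicRel Q.map {x₀} := by
  classical
  have hcoord : ∀ x U, ((q.bonding.comp P.map) x).1 U =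
      ∑ᶠ V, (q.toFun ⁻¹' {U}).indicator (fun V => P.φ V x) V := fun x U => rfl
  refine Realization.homotopicRel_of_coord _ _ (fun U => ?_) (fun U => (Q.φ U).continuous) ?_
    Q.φ.locallyFinite (fun x => ?_) _ ?_
  · simp_rw [hcoord]
    refine continuous_finsum (fun V => ?_) (P.φ.locallyFinite.subset fun V x hx => ?_)
    · by_cases hv : V ∈ q.toFun ⁻¹' {U}
      · simp_rw [Set.indicator_of_mem hv]
        exact (P.φ V).continuous
      · simp_rw [Set.indicator_of_notMem hv]
        exact continuous_const
    · exact (Set.indicator_apply_ne_zero.1 hx).2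
  · intro x
    obtain ⟨O, hO, hfin⟩ := P.φ.locallyFinite x
    refine ⟨O, hO, (hfin.image q.toFun).subset ?_⟩
    rintro U ⟨y, hy, hyO⟩
    rw [Function.mem_support, hcoord] at hy
    obtain ⟨V, hV⟩ : ∃ V, (q.toFun ⁻¹' {U}).indicator (fun V => P.φ V y) V ≠ 0 := by
      by_contra! h
      exact hy (by simp only [h, finsum_zero])
    have := Set.indicator_apply_ne_zero.1 hV
    exact ⟨V, ⟨y, this.2, hyO⟩, this.1⟩
  · obtain ⟨s, hs, hs'⟩ := P.mem_closedSimplex x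
    obtain ⟨t, ht, ht'⟩ := Q.mem_closedSimplex x
    have hp := Realization.pushCoord_mem q.toFun
      (fun V hV => Finset.mem_image_of_mem q.toFun hV) hs'
    refine ⟨s.image q.toFun ∪ t, ⟨(nonempty_of_mem_closedSimplex ht').mono
      Finset.subset_union_right, x, fun U hU => ?_⟩, ?_, ?_⟩
    · rcases Finset.mem_union.1 hU with hU | hU
      · obtain ⟨V, hV, rfl⟩ := Finset.mem_image.1 hU
        exact q.subset V (hs V hV)
      · exact ht U hU
    · exact ⟨hp.1.trans (by simp), hp.2⟩
    · exact ⟨ht'.1.trans (by simp), ht'.2⟩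
  · rintro x rfl
    rw [ContinuousMap.comp_apply, P.map_basepoint, q.bonding_basepoint, Q.map_basepoint]

end PointedCover

/-- The (underlying space of the) `n`-th shape homotopy group of `(X, x₀)`: the inverse limit of
the sets `π_n(|N(𝒰)|, U₀)` over all pointed covers, ordered by refinement. Since the simplicial map
of a refinement is unique up to based homotopy, requiring compatibility for every choice of it
is the same as requiring it for one choice. -/
def ShapeHomotopyGroup (n : ℕ) {X : Type*} [TopologicalSpace X] (x₀ : X) : Type _ :=
  {a : ∀ 𝒰 : PointedCover x₀, π_ n 𝒰.NerveSpace 𝒰.basepoint //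
    ∀ (𝒱 𝒰 : PointedCover x₀) (q : PointedCover.Refinement 𝒱 𝒰),
      homotopyGroupMap n q.bonding q.bonding_basepoint (a 𝒱) = a 𝒰}

/-- The inverse limit topology, the groups `π_n(|N(𝒰)|, U₀)` being discrete. -/
instance (n : ℕ) {X : Type*} [TopologicalSpace X] (x₀ : X) :
    TopologicalSpace (ShapeHomotopyGroup n x₀) :=
  TopologicalSpace.induced Subtype.val
    (@Pi.topologicalSpace (PointedCover x₀) (fun 𝒰 => π_ n 𝒰.NerveSpace 𝒰.basepoint) fun _ => ⊥)

/-- The `n`-th shape homomorphism `Ψ_n([α]) = ([p_𝒰 ∘ α])_𝒰`. The partitions of unity defining the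
maps `p_𝒰` are chosen; the classes do not depend on the choice. -/
def shapeHom (n : ℕ) {X : Type*} [TopologicalSpace X] [T4Space X] (x₀ : X) (a : π_ n X x₀) :
    ShapeHomotopyGroup n x₀ :=
  ⟨fun 𝒰 => homotopyGroupMap n 𝒰.exists_canonicalPartition.some.map
      (PointedCover.CanonicalPartition.map_basepoint _) a, fun 𝒱 𝒰 q => by
    rw [homotopyGroupMap_comp n _ _ _ _ (by
      rw [ContinuousMap.comp_apply, PointedCover.CanonicalPartition.map_basepoint,
        q.bonding_basepoint])]
    exact homotopyGroupMap_congr n _ _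
      (PointedCover.CanonicalPartition.bonding_comp_map _ _ q) a⟩

/-- The shape topology on `π_n(X, x₀)`: the initial topology with respect to `Ψ_n`. -/
@[reducible] def shapeTopology (n : ℕ) {X : Type*} [TopologicalSpace X] [T4Space X] (x₀ : X) :
    TopologicalSpace (π_ n X x₀) :=
  TopologicalSpace.induced (shapeHom n x₀) inferInstance

end

/-! Fix a `ρ`-open set, a point `a` of it and a ball of radius `ε` around `a` inside it. Since `X`
is compact, some projection `f : X → Y j` has all fibres of diameter less than `ε / 2`. Composing
bonding maps below `j` and sections above `j` gives a section `g` of `f`. Then `e = g ∘ f` moves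
points within fibres of `f`, so it is `ε / 2`-close to the identity, and it is idempotent.

As `Y j` is a finite polyhedron, `f` factors up to free homotopy through the nerve of the cover of
`X` by preimages of open stars. If `Ψ_n(a)` and `Ψ_n(b)` agree at this one cover, then `f ∘ α` and
`f ∘ β` are homotopic as based loops, hence so are `e ∘ α` and `e ∘ β`. Agreement at a single cover
is an open condition in the shape topology, so it remains to show `ρ(a, b) ≤ ε / 2`.

The obstacle is that `e` need not fix `x₀`, and a path `γ` from `x₀` to `e x₀`, which
path-connectedness supplies, may be long. The path `δ = γ · (e ∘ γ)⁻¹` ends at `e x₀` and is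
uniformly close to the null-homotopic loop `θ = γ · γ⁻¹`. Write `α'`, `β'` for `e ∘ α`, `e ∘ β`
transported along `δ`, and `α''`, `β''` for `α`, `β` transported along `θ`. Then `α'` is close to
`α''`, `β'` is close to `β''`, `[α'] = [β']`, `[α''] = a` and `[β''] = b`. The classes `a [α']⁻¹
[β'] = a` and `a [α'']⁻¹ [β''] = b` have representatives built by the same formula from pairwise
close loops, which bounds `ρ(a, b)` directly, without a triangle inequality
(`homotopyPseudodist_le_of_homotopic_comp`). -/

/-! ## Change of basepoint for generalized loops -/

section ChangeBase

variable {X : Type*} {n : ℕ}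

/-- The doubling of the cube `[1/4, 3/4]^n` onto `[0, 1]^n`, extended to `[0, 1]^n` by clamping. -/
noncomputable def Cube.double (t : I^ (Fin n)) : I^ (Fin n) :=
  fun i => Set.projIcc 0 1 zero_le_one (2 * (t i : ℝ) - 1 / 2)

/-- The distance to the centre of the cube, normalized to be `1` on the boundary. -/
noncomputable def Cube.radius (t : I^ (Fin n)) : ℝ := ‖fun i => 2 * (t i : ℝ) - 1‖

theorem Cube.continuous_double : Continuous (Cube.double (n := n)) :=
  continuous_pi fun i => continuous_projIcc.comp (by fun_prop)

theorem Cube.continuous_radius : Continuous (Cube.radius (n := n)) := by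
  unfold Cube.radius
  fun_prop

/-- Some coordinate is then clamped to an endpoint. Hence a loop composed with `Cube.double` is
constant on the collar. -/
theorem Cube.double_mem_boundary {t : I^ (Fin n)} (ht : 1 / 2 ≤ Cube.radius t) :
    Cube.double t ∈ Cube.boundary (Fin n) := by
  obtain ⟨i, hi⟩ : ∃ i, 1 / 2 ≤ ‖2 * (t i : ℝ) - 1‖ := by
    by_contra! h
    exact absurd ((pi_norm_lt_iff (by norm_num)).2 h) (not_lt.2 ht)
  refine ⟨i, ?_⟩
  rw [Real.norm_eq_abs, le_abs] at hi
  rcases hi with hi | hi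
  · exact Or.inr (Set.projIcc_of_right_le _ (by linarith))
  · exact Or.inl (Set.projIcc_of_le_left _ (by linarith))

theorem Cube.one_le_radius {t : I^ (Fin n)} (ht : t ∈ Cube.boundary (Fin n)) :
    1 ≤ Cube.radius t := by
  obtain ⟨i, hi⟩ := ht
  refine le_trans ?_ (norm_le_pi_norm (fun i => 2 * (t i : ℝ) - 1) i)
  rcases hi with hi | hi <;> rw [Real.norm_eq_abs, hi] <;> norm_num

/-- The map of the cube given by `a` on the inner cube and by `b` along the radii of the collar. -/
noncomputable def Cube.collar (a : (I^ (Fin n)) → X) (b : I → X) (t : I^ (Fin n)) : X :=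
  if Cube.radius t ≤ 1 / 2 then a (Cube.double t)
  else b (Set.projIcc 0 1 zero_le_one (2 - 2 * Cube.radius t))

theorem Cube.collar_of_mem_boundary (a : (I^ (Fin n)) → X) (b : I → X) {t : I^ (Fin n)}
    (ht : t ∈ Cube.boundary (Fin n)) : Cube.collar a b t = b 0 := by
  have h := Cube.one_le_radius ht
  rw [Cube.collar, if_neg (by linarith), Set.projIcc_of_le_left _ (by linarith)]
  rfl

variable [TopologicalSpace X]

/-- The parameter space `Z` lets one statement serve both for single loops (`Z = Unit`) and for
homotopies (`Z = I`). -/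
theorem Cube.continuous_collar {Z : Type*} [TopologicalSpace Z] {A : Z → (I^ (Fin n)) → X}
    {B : Z → I → X} (hA : Continuous fun p : Z × (I^ (Fin n)) => A p.1 p.2)
    (hB : Continuous fun p : Z × I => B p.1 p.2)
    (hAB : ∀ z, ∀ t ∈ Cube.boundary (Fin n), A z t = B z 1) :
    Continuous fun p : Z × (I^ (Fin n)) => Cube.collar (A p.1) (B p.1) p.2 := by
  have hr : Continuous fun p : Z × (I^ (Fin n)) => Cube.radius p.2 :=
    Cube.continuous_radius.comp continuous_snd
  refine Continuous.if_le ?_ ?_ hr continuous_const fun p hp => ?_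
  · exact hA.comp (continuous_fst.prodMk (Cube.continuous_double.comp continuous_snd))
  · exact hB.comp (continuous_fst.prodMk ((continuous_projIcc (h := zero_le_one)).comp
      (continuous_const.sub (hr.const_mul 2))))
  -- The pieces meet where the radius is `1 / 2`: there the collar parameter `2 - 2 * radius` equals
  -- `1`, and it falls to `0` on the boundary of the cube.
  · rw [hAB _ _ (Cube.double_mem_boundary hp.ge), Set.projIcc_of_right_le _ (by linarith)]
    rfl

theorem GenLoop.homotopic_of_continuous {x : X} {α β : Ω^ (Fin n) X x}
    (G : I → (I^ (Fin n)) → X) (hG : Continuous fun p : I × (I^ (Fin n)) => G p.1 p.2)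
    (h0 : ∀ t, G 0 t = α t) (h1 : ∀ t, G 1 t = β t)
    (hb : ∀ u, ∀ t ∈ Cube.boundary (Fin n), G u t = x) : GenLoop.Homotopic α β :=
  ⟨⟨⟨⟨fun p => G p.1 p.2, hG⟩, h0, h1⟩, fun u t ht => (hb u t ht).trans (α.2 t ht).symm⟩⟩

/-- The `n`-loop at `x` obtained from an `n`-loop at `y` by attaching a path from `x` to `y`. -/
noncomputable def GenLoop.changeBase {x y : X} (η : Path x y) (α : Ω^ (Fin n) X y) :
    Ω^ (Fin n) X x :=
  ⟨⟨Cube.collar α η, (Cube.continuous_collar (Z := Unit) (A := fun _ => α) (B := fun _ => η)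
      (α.1.continuous.comp continuous_snd) (η.continuous.comp continuous_snd)
      fun _ t ht => by rw [η.target]; exact α.2 t ht).comp
      (Continuous.prodMk_right ())⟩,
    fun t ht => (Cube.collar_of_mem_boundary _ _ ht).trans η.source⟩

theorem GenLoop.changeBase_apply {x y : X} (η : Path x y) (α : Ω^ (Fin n) X y)
    (t : I^ (Fin n)) : GenLoop.changeBase η α t = Cube.collar α η t := rfl

theorem GenLoop.changeBase_congr {x y : X} {η η' : Path x y} {α α' : Ω^ (Fin n) X y}
    (hη : Path.Homotopic η η') (hα : GenLoop.Homotopic α α') :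
    GenLoop.Homotopic (GenLoop.changeBase η α) (GenLoop.changeBase η' α') := by
  obtain ⟨P⟩ := hη
  obtain ⟨F⟩ := hα
  refine GenLoop.homotopic_of_continuous
    (fun u => Cube.collar (fun t => F (u, t)) fun v => P (u, v))
    (Cube.continuous_collar (A := fun u t => F (u, t)) (B := fun u v => P (u, v))
      F.continuous P.continuous fun u t ht => ?_) (fun t => ?_) (fun t => ?_) fun u t ht => ?_
  · rw [P.target, F.eq_fst u ht]
    exact α.2 t ht
  · simp only [F.apply_zero, P.apply_zero]
    rfl
  · simp only [F.apply_one, P.apply_one]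
    rfl
  · rw [Cube.collar_of_mem_boundary _ _ ht, P.source]

/-- Interpolate linearly in each coordinate between `t` and `2 * t - 1 / 2`, then clamp; faces of
the cube stay in the same face throughout. -/
theorem GenLoop.homotopic_changeBase_refl {x : X} (α : Ω^ (Fin n) X x) :
    GenLoop.Homotopic α (GenLoop.changeBase (Path.refl x) α) := by
  have hα : Continuous α := α.1.continuous
  refine GenLoop.homotopic_of_continuous (fun u t => α fun i => Set.projIcc 0 1 zero_le_one
    ((1 - (u : ℝ)) * t i + u * (2 * t i - 1 / 2))) ?_ (fun t => ?_) (fun t => ?_) fun u t ht => ?_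
  · exact hα.comp (continuous_pi fun i => continuous_projIcc.comp (by fun_prop))
  · congr 1
    funext i
    simp
  · rw [GenLoop.changeBase_apply, Cube.collar]
    have h : (fun i => Set.projIcc 0 1 zero_le_one
        ((1 - ((1 : I) : ℝ)) * t i + ((1 : I) : ℝ) * (2 * t i - 1 / 2))) = Cube.double t := by
      funext i
      simp [Cube.double]
    rw [h]
    -- Off the inner cube the left side is `α` at a boundary point, which is the constant value of
    -- the collar.
    split_ifs with hr
    · rfl
    · exact α.2 _ (Cube.double_mem_boundary (le_of_not_ge hr))
  · refine α.2 _ ?_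
    obtain ⟨i, hi⟩ := ht
    have h0 := u.2.1
    have h1 := u.2.2
    refine ⟨i, ?_⟩
    rcases hi with hi | hi
    · exact Or.inl (Set.projIcc_of_le_left _ (by rw [hi, Set.Icc.coe_zero]; linarith))
    · exact Or.inr (Set.projIcc_of_right_le _ (by rw [hi, Set.Icc.coe_one]; linarith))

/-- A free homotopy of `n`-loops relates them by the change of basepoint along its track. -/
theorem GenLoop.homotopic_changeBase {x y : X} {α : Ω^ (Fin n) X x} {β : Ω^ (Fin n) X y}
    (η : Path x y) (H : C(I × (I^ (Fin n)), X)) (h0 : ∀ t, H (0, t) = α t)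
    (h1 : ∀ t, H (1, t) = β t) (hb : ∀ u, ∀ t ∈ Cube.boundary (Fin n), H (u, t) = η u) :
    GenLoop.Homotopic α (GenLoop.changeBase η β) := by
  -- At time `u` the loop `H (u, ·)` is based at `η u`; the collar joins it to `x` along the part of
  -- `η` over `[0, u]`.
  refine (GenLoop.homotopic_changeBase_refl α).trans (GenLoop.homotopic_of_continuous
    (fun u => Cube.collar (fun t => H (u, t)) fun v => η (u * v))
    (Cube.continuous_collar (A := fun u t => H (u, t)) (B := fun u v => η (u * v))
      H.continuous (by fun_prop) fun u t ht => ?_) (fun t => ?_) (fun t => ?_) fun u t ht => ?_)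
  · rw [mul_one, hb u t ht]
  · simp only [h0, zero_mul, Path.source]
    rfl
  · simp only [h1, one_mul]
    rfl
  · rw [Cube.collar_of_mem_boundary _ _ ht, mul_zero, η.source]

end ChangeBase

/-! ## Estimates for the pseudometric -/

section Estimates

variable {X : Type*} [MetricSpace X] {n : ℕ} {ε : ℝ}

theorem homotopyPseudodist_le {x₀ : X} {a b : π_ n X x₀} {α β : Ω^ (Fin n) X x₀}
    (ha : (Quotient.mk _ α : π_ n X x₀) = a) (hb : (Quotient.mk _ β : π_ n X x₀) = b)
    (h : ∀ t, dist (α t) (β t) ≤ ε) : homotopyPseudodist a b ≤ ε := by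
  have hle : homotopyPseudodist a b ≤ uniformDist α β := by
    refine csInf_le ⟨0, ?_⟩ ⟨α, β, ha, hb, rfl⟩
    rintro _ ⟨α', β', -, -, rfl⟩
    exact Real.iSup_nonneg fun t => dist_nonneg
  exact hle.trans (ciSup_le h)

/-- Concatenation applies the same reparametrization to both pairs, so the distance is bounded by
the maximum, not the sum, of the two distances. Inversion and change of basepoint below behave
alike. -/
theorem GenLoop.dist_transAt_le {x₀ : X} (i : Fin n) {f g f' g' : Ω^ (Fin n) X x₀}
    (hf : ∀ t, dist (f t) (f' t) ≤ ε) (hg : ∀ t, dist (g t) (g' t) ≤ ε) (t : I^ (Fin n)) :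
    dist (GenLoop.transAt i f g t) (GenLoop.transAt i f' g' t) ≤ ε := by
  simp only [GenLoop.transAt, GenLoop.coe_copy]
  split_ifs
  · exact hf _
  · exact hg _

theorem GenLoop.dist_symmAt_le {x₀ : X} (i : Fin n) {f f' : Ω^ (Fin n) X x₀}
    (hf : ∀ t, dist (f t) (f' t) ≤ ε) (t : I^ (Fin n)) :
    dist (GenLoop.symmAt i f t) (GenLoop.symmAt i f' t) ≤ ε := by
  simp only [GenLoop.symmAt, GenLoop.coe_copy]
  exact hf _

theorem GenLoop.dist_changeBase_le {x y z : X} {η : Path x y} {θ : Path x z}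
    {α : Ω^ (Fin n) X y} {β : Ω^ (Fin n) X z} (hη : ∀ u, dist (η u) (θ u) ≤ ε)
    (hα : ∀ t, dist (α t) (β t) ≤ ε) (t : I^ (Fin n)) :
    dist (GenLoop.changeBase η α t) (GenLoop.changeBase θ β t) ≤ ε := by
  simp only [GenLoop.changeBase_apply, Cube.collar]
  split_ifs
  · exact hα _
  · exact hη _

/-- If `e` is `ε`-close to the identity and `e ∘ α`, `e ∘ β` are homotopic, then the classes of
`α` and `β` are at distance at most `ε`. The path from `x₀` to the fixed point `e x₀` need not be
small. -/
theorem homotopyPseudodist_le_of_homotopic_comp (hn : 1 ≤ n) {x₀ : X} (e : C(X, X))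
    (he : ∀ x, dist (e x) x ≤ ε) (hfix : e (e x₀) = e x₀) (γ : Path x₀ (e x₀))
    {α β : Ω^ (Fin n) X x₀}
    (h : GenLoop.Homotopic (loopComp e rfl α) (loopComp e rfl β)) :
    homotopyPseudodist (Quotient.mk _ α : π_ n X x₀) (Quotient.mk _ β) ≤ ε := by
  have : Nonempty (Fin n) := ⟨⟨0, hn⟩⟩
  let i : Fin n := ⟨0, hn⟩
  have hε : 0 ≤ ε := dist_nonneg.trans (he x₀)
  -- On the first half `δ` and `θ` coincide; on the second they are `e ∘ γ⁻¹` and `γ⁻¹`, so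
  -- closeness of `e` to the identity suffices however long `γ` is.
  let δ : Path x₀ (e x₀) := γ.trans ((γ.symm.map e.continuous).cast hfix.symm rfl)
  let θ : Path x₀ x₀ := γ.trans γ.symm
  have hδ : ∀ u, dist (δ u) (θ u) ≤ ε := fun u => by
    simp only [δ, θ, Path.trans_apply]
    split_ifs
    · rwa [dist_self]
    · exact he _
  have hθ : ∀ ω : Ω^ (Fin n) X x₀,
      (Quotient.mk _ (GenLoop.changeBase θ ω) : π_ n X x₀) = Quotient.mk _ ω := fun ω =>
    Quotient.sound ((GenLoop.changeBase_congr
      (Nonempty.intro (Path.Homotopy.reflTransSymm γ).symm) (GenLoop.Homotopic.refl ω)).trans (GenLoop.homotopic_changeBase_refl ω).symm)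
  have hc : ∀ ω : Ω^ (Fin n) X x₀, ∀ t, dist (GenLoop.changeBase δ (loopComp e rfl ω) t)
      (GenLoop.changeBase θ ω t) ≤ ε := fun ω =>
    GenLoop.dist_changeBase_le hδ fun t => he (ω t)
  let cls : Ω^ (Fin n) X x₀ → HomotopyGroup (Fin n) X x₀ := fun ω => Quotient.mk _ ω
  -- The order reverses because a product of classes is represented by `transAt` with its factors
  -- swapped.
  have hclass : ∀ p q r : Ω^ (Fin n) X x₀,
      cls (GenLoop.transAt i p (GenLoop.transAt i (GenLoop.symmAt i q) r)) =
        cls r * (cls q)⁻¹ * cls p := fun p q r => by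
    have hq : (cls q)⁻¹ = cls (GenLoop.symmAt i q) := HomotopyGroup.inv_spec
    have hm : ∀ p q, cls p * cls q = cls (GenLoop.transAt i q p) := fun p q =>
      HomotopyGroup.mul_spec
    rw [hq, hm, hm]
  -- The two loops have the same shape: the first cancels because the `δ`-transports are homotopic,
  -- the second because the `θ`-transports represent the classes of `α` and `β`.
  refine homotopyPseudodist_le
    (α := GenLoop.transAt i (GenLoop.changeBase δ (loopComp e rfl β)) (GenLoop.transAt i
      (GenLoop.symmAt i (GenLoop.changeBase δ (loopComp e rfl α))) α))
    (β := GenLoop.transAt i (GenLoop.changeBase θ β) (GenLoop.transAt i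
      (GenLoop.symmAt i (GenLoop.changeBase θ α)) α)) ?_ ?_
    (GenLoop.dist_transAt_le i (hc β) (GenLoop.dist_transAt_le i
      (GenLoop.dist_symmAt_le i (hc α)) fun t => by rwa [dist_self]))
  · have hαβ : cls (GenLoop.changeBase δ (loopComp e rfl α)) =
        cls (GenLoop.changeBase δ (loopComp e rfl β)) :=
      Quotient.sound (GenLoop.changeBase_congr (Path.Homotopic.refl δ) h)
    exact (hclass _ _ _).trans (by rw [hαβ, inv_mul_cancel_right])
  · have h1 : cls (GenLoop.changeBase θ α) = cls α := hθ α
    have h2 : cls (GenLoop.changeBase θ β) = cls β := hθ β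
    exact (hclass _ _ _).trans (by rw [h1, h2, mul_inv_cancel, one_mul])

end Estimates

/-! ## Maps into finite polyhedra factor through nerves up to homotopy -/

section Polyhedra

/-- The factorization is only up to free homotopy, but both loops are transported along the same
track of the basepoint `x`, so a based homotopy survives. -/
theorem ContinuousMap.Homotopic.genLoop_homotopic {X Z W : Type*} [TopologicalSpace X]
    [TopologicalSpace Z] [TopologicalSpace W] {n : ℕ} {f : C(X, Z)} {p : C(X, W)} {g : C(W, Z)}
    (H : f.Homotopic (g.comp p)) {x : X} {w : W} (hp : p x = w) {α β : Ω^ (Fin n) X x}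
    (h : GenLoop.Homotopic (loopComp p hp α) (loopComp p hp β)) :
    GenLoop.Homotopic (loopComp f rfl α) (loopComp f rfl β) := by
  subst hp
  obtain ⟨H⟩ := H
  have key : ∀ ω : Ω^ (Fin n) X x, GenLoop.Homotopic (loopComp f rfl ω)
      (GenLoop.changeBase (H.evalAt x) (loopComp g rfl (loopComp p rfl ω))) := fun ω =>
    GenLoop.homotopic_changeBase _
      ⟨fun q => H (q.1, ω q.2), H.continuous.comp (continuous_fst.prodMk
        (ω.1.continuous.comp continuous_snd))⟩
      (fun t => H.apply_zero _) (fun t => H.apply_one _)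
      fun u t ht => congrArg (fun y => H (u, y)) (ω.2 t ht)
  have hg : GenLoop.Homotopic (loopComp g rfl (loopComp p rfl α))
      (loopComp g rfl (loopComp p rfl β)) := ContinuousMap.HomotopicRel.comp_continuousMap h g
  exact (key α).trans
    ((GenLoop.changeBase_congr (Path.Homotopic.refl _) hg).trans (key β).symm)

variable {E : Type*} [NormedAddCommGroup E] [NormedSpace ℝ E]
  (K : Geometry.SimplicialComplex ℝ E)

/-- The points all of whose carrying closed simplices have the vertex `v`; for points of the
underlying space this is the open star of `v`. -/
def Geometry.SimplicialComplex.openStar (v : E) : Set E :=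
  {x | ∀ s ∈ K.faces, x ∈ convexHull ℝ (s : Set E) → v ∈ s}

variable {K}

theorem Geometry.SimplicialComplex.isOpen_openStar (hK : K.faces.Finite) (v : E) :
    IsOpen (K.openStar v) := by
  have h : K.openStar v =
      (⋃ s ∈ {s ∈ K.faces | v ∉ s}, convexHull ℝ (s : Set E))ᶜ := by
    ext x
    simp only [openStar, Set.mem_ofPred_eq, Set.mem_compl_iff, Set.mem_iUnion, not_exists]
    exact ⟨fun h s hs hx => hs.2 (h s hs.1 hx), fun h s hs hx => by_contra fun hv => h s ⟨hs, hv⟩ hx⟩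
  rw [h, isOpen_compl_iff]
  exact (hK.subset (Set.sep_subset _ _)).isClosed_biUnion fun s _ =>
    (s.finite_toSet.isCompact_convexHull ℝ).isClosed

/-- Take a face `s` of least cardinality whose hull contains `x`. For any other such face `t`, the
face `s ∩ t` also carries `x`, so minimality forces `s ⊆ t`; every vertex of `s` works. -/
theorem Geometry.SimplicialComplex.exists_mem_openStar {x : E} (hx : x ∈ K.space) :
    ∃ s ∈ K.faces, ∃ v ∈ s, x ∈ K.openStar v := by
  classical
  have hex : ∃ k, ∃ s ∈ K.faces, x ∈ convexHull ℝ (s : Set E) ∧ s.card = k := by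
    obtain ⟨s, hs, hxs⟩ := K.mem_space_iff.1 hx
    exact ⟨_, s, hs, hxs, rfl⟩
  obtain ⟨s, hs, hxs, hcard⟩ := Nat.find_spec hex
  obtain ⟨v, hv⟩ := K.nonempty_of_mem_faces hs
  refine ⟨s, hs, v, hv, fun t ht hxt => ?_⟩
  have hst : x ∈ convexHull ℝ ((s ∩ t : Finset E) : Set E) := by
    rw [Finset.coe_inter]
    exact K.inter_subset_convexHull hs ht ⟨hxs, hxt⟩
  have hne : (s ∩ t).Nonempty := by
    simpa only [Finset.coe_nonempty] using convexHull_nonempty_iff.1 ⟨x, hst⟩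
  have hmin := Nat.find_min' hex
    ⟨s ∩ t, K.down_closed hs Finset.inter_subset_left hne, hst, rfl⟩
  rw [← hcard] at hmin
  exact Finset.inter_eq_left.1 (Finset.eq_of_subset_of_card_le Finset.inter_subset_left hmin) hv

theorem Geometry.SimplicialComplex.isCompact_space (hK : K.faces.Finite) : IsCompact K.space :=
  hK.isCompact_biUnion fun s _ => s.finite_toSet.isCompact_convexHull ℝ

variable {X : Type*} [TopologicalSpace X] {x₀ : X}

/-- The cover by preimages of open stars, with a choice of vertices of the stars. -/
theorem PointedCover.exists_vertex_map (hK : K.faces.Finite) (f : C(X, K.space)) (x₀ : X) :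
    ∃ (𝒰 : PointedCover x₀) (w : 𝒰.sets → E), ∀ (U : 𝒰.sets), ∀ x ∈ (U : Set X),
      ∀ s ∈ K.faces, (f x : E) ∈ convexHull ℝ (s : Set E) → w U ∈ s := by
  let V : Set E := ⋃ s ∈ K.faces, (s : Set E)
  have hV : V.Finite := hK.biUnion fun s _ => s.finite_toSet
  let S : E → Set X := fun v => {x | (f x : E) ∈ K.openStar v}
  have hcov : ∀ x, ∃ v ∈ V, x ∈ S v := fun x => by
    obtain ⟨s, hs, v, hv, hx⟩ := Geometry.SimplicialComplex.exists_mem_openStar (f x).2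
    exact ⟨v, Set.mem_biUnion hs hv, hx⟩
  have hfin : Finite (S '' V) := hV.image S
  obtain ⟨v₀, hv₀, hx₀⟩ := hcov x₀
  let 𝒰 : PointedCover x₀ :=
    { sets := S '' V
      isOpen := by
        rintro _ ⟨v, -, rfl⟩
        exact (Geometry.SimplicialComplex.isOpen_openStar hK v).preimage
          (continuous_subtype_val.comp f.continuous)
      covers := Set.eq_univ_of_forall fun x => by
        obtain ⟨v, hv, hx⟩ := hcov x
        exact ⟨S v, ⟨v, hv, rfl⟩, hx⟩
      locallyFinite := locallyFinite_of_finite _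
      base := ⟨S v₀, v₀, hv₀, rfl⟩
      mem_base := hx₀ }
  -- The cover is a set of sets, and several vertices may have the same preimage, so each member
  -- needs a chosen vertex.
  choose w hw using fun U : 𝒰.sets => U.2
  refine ⟨𝒰, w, fun U x hx s hs hxs => ?_⟩
  rw [← (hw U).2] at hx
  exact hx s hs hxs

theorem PreAbstractSimplicialComplex.finsum_smul_mem_convexHull {V : Type*} {T : Finset V}
    {ξ : V → ℝ} (hξ : ξ ∈ closedSimplex T) {w : V → E} {s : Set E} (hw : ∀ v ∈ T, w v ∈ s) :
    ∑ᶠ v, ξ v • w v ∈ convexHull ℝ s := by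
  obtain ⟨h1, h2, h3⟩ := hξ
  rw [finsum_eq_sum_of_support_subset _ h1] at h3
  rw [finsum_eq_sum_of_support_subset (s := T) (fun v => ξ v • w v)
    ((Function.support_smul_subset_left ξ w).trans h1)]
  exact (convex_convexHull ℝ s).sum_mem (fun v _ => h2 v) h3
    fun v hv => subset_convexHull ℝ s (hw v hv)

/-- The affine map from the nerve to a simplicial complex given by a compatible vertex map. -/
theorem PointedCover.exists_nerve_map {f : C(X, K.space)} {𝒰 : PointedCover x₀}
    {w : 𝒰.sets → E} (hw : ∀ (U : 𝒰.sets), ∀ x ∈ (U : Set X),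
      ∀ s ∈ K.faces, (f x : E) ∈ convexHull ℝ (s : Set E) → w U ∈ s) :
    ∃ g : C(𝒰.NerveSpace, K.space), ∀ ξ, (g ξ : E) = ∑ᶠ U, ξ.1 U • w U := by
  have hmem : ∀ ξ : 𝒰.NerveSpace, ∑ᶠ U, ξ.1 U • w U ∈ K.space := fun ξ => by
    obtain ⟨T, ⟨-, x, hx⟩, hξ⟩ := ξ.2
    obtain ⟨s, hs, hxs⟩ := K.mem_space_iff.1 (f x).2
    exact K.convexHull_subset_space hs (PreAbstractSimplicialComplex.finsum_smul_mem_convexHull hξ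
      fun U hU => hw U x (hx U hU) s hs hxs)
  refine ⟨⟨fun ξ => ⟨_, hmem ξ⟩, Continuous.subtype_mk ?_ _⟩, fun ξ => rfl⟩
  refine continuous_iSup_dom.2 fun T => continuous_coinduced_dom.2 ?_
  have hsum : ∀ ξ : PreAbstractSimplicialComplex.closedSimplex (T : Finset 𝒰.sets),
      ∑ᶠ U, ξ.1 U • w U = ∑ U ∈ (T : Finset 𝒰.sets), ξ.1 U • w U := fun ξ =>
    finsum_eq_sum_of_support_subset _ ((Function.support_smul_subset_left ξ.1 w).trans ξ.2.1)
  change Continuous fun ξ : PreAbstractSimplicialComplex.closedSimplex (T : Finset 𝒰.sets) =>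
    ∑ᶠ U, ξ.1 U • w U
  simp_rw [hsum]
  exact continuous_finsetSum _ fun U _ =>
    ((continuous_apply U).comp continuous_subtype_val).smul continuous_const

/-- A face carrying `f x` contains `w U` for every member `U` containing `x`, hence its hull
contains `g (P.map x)`, and the straight-line homotopy stays in `K.space`. It may move `x₀`, since
`w` at the base member need not be `f x₀`. -/
theorem PointedCover.homotopic_nerve_map {f : C(X, K.space)} {𝒰 : PointedCover x₀}
    {w : 𝒰.sets → E} (hw : ∀ (U : 𝒰.sets), ∀ x ∈ (U : Set X),
      ∀ s ∈ K.faces, (f x : E) ∈ convexHull ℝ (s : Set E) → w U ∈ s)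
    {g : C(𝒰.NerveSpace, K.space)} (hg : ∀ ξ, (g ξ : E) = ∑ᶠ U, ξ.1 U • w U)
    (P : 𝒰.CanonicalPartition) : f.Homotopic (g.comp P.map) := by
  have hmem : ∀ q : I × X,
      (1 - (q.1 : ℝ)) • (f q.2 : E) + (q.1 : ℝ) • (g (P.map q.2) : E) ∈ K.space := fun q => by
    obtain ⟨s, hs, hxs⟩ := K.mem_space_iff.1 (f q.2).2
    obtain ⟨T, hT, hξ⟩ := P.mem_closedSimplex q.2
    have hgs : (g (P.map q.2) : E) ∈ convexHull ℝ (s : Set E) := by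
      rw [hg]
      exact PreAbstractSimplicialComplex.finsum_smul_mem_convexHull hξ
        fun U hU => hw U q.2 (hT U hU) s hs hxs
    exact K.convexHull_subset_space hs (convex_convexHull ℝ _ hxs hgs
      (sub_nonneg.2 q.1.2.2) q.1.2.1 (sub_add_cancel _ _))
  refine ⟨⟨⟨fun q => ⟨_, hmem q⟩, Continuous.subtype_mk (by fun_prop) _⟩, fun x => ?_, fun x => ?_⟩⟩
  · exact Subtype.ext (by simp)
  · exact Subtype.ext (by simp)

/-- The cover is found before the partition of unity, so the conclusion applies to whichever
partition `shapeHom` selects. -/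
theorem IsFinitePolyhedron.exists_pointedCover {Y : Type*} [TopologicalSpace Y]
    (hY : IsFinitePolyhedron Y) (f : C(X, Y)) (x₀ : X) :
    ∃ 𝒰 : PointedCover x₀, ∀ (P : 𝒰.CanonicalPartition) (n : ℕ) (α β : Ω^ (Fin n) X x₀),
      GenLoop.Homotopic (loopComp P.map P.map_basepoint α) (loopComp P.map P.map_basepoint β) →
        GenLoop.Homotopic (loopComp f rfl α) (loopComp f rfl β) := by
  obtain ⟨N, K, hK, ⟨φ⟩⟩ := hY
  obtain ⟨𝒰, w, hw⟩ := PointedCover.exists_vertex_map hK ((φ : C(Y, K.space)).comp f) x₀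
  obtain ⟨g, hg⟩ := PointedCover.exists_nerve_map hw
  refine ⟨𝒰, fun P n α β h => ?_⟩
  have H : f.Homotopic (((φ.symm : C(K.space, Y)).comp g).comp P.map) := by
    have := (ContinuousMap.Homotopic.refl (φ.symm : C(K.space, Y))).comp
      (PointedCover.homotopic_nerve_map hw hg P)
    rwa [← ContinuousMap.comp_assoc, Homeomorph.symm_comp_toContinuousMap,
      ContinuousMap.id_comp] at this
  exact H.genLoop_homotopic P.map_basepoint h

theorem IsFinitePolyhedron.compactSpace {Y : Type*} [TopologicalSpace Y]
    (hY : IsFinitePolyhedron Y) : CompactSpace Y := by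
  obtain ⟨N, K, hK, ⟨φ⟩⟩ := hY
  have := isCompact_iff_compactSpace.1 (Geometry.SimplicialComplex.isCompact_space hK)
  exact φ.symm.compactSpace

theorem IsFinitePolyhedron.t2Space {Y : Type*} [TopologicalSpace Y]
    (hY : IsFinitePolyhedron Y) : T2Space Y := by
  obtain ⟨N, K, hK, ⟨φ⟩⟩ := hY
  exact φ.symm.t2Space

end Polyhedra

/-! ## Inverse limits of retractions -/

section Limits

universe u

/-- The maps `c i` are composites of bonding maps for `i < j` and of sections for `i > j`. Being
compatible, they assemble to a map from `Y j` into the inverse limit. -/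
theorem exists_compatible_sections (j : ℕ) : ∀ (Y : ℕ → Type u) [∀ j, TopologicalSpace (Y j)]
    (r : ∀ j, C(Y (j + 1), Y j)), (∀ j, IsRetractionMap (r j)) →
    ∃ c : ∀ i, C(Y j, Y i), (∀ i, (r i).comp (c (i + 1)) = c i) ∧
      c j = ContinuousMap.id (Y j) := by
  induction j with
  | zero =>
    intro Y _ r hr
    choose s hs using hr
    refine ⟨fun i => Nat.rec (ContinuousMap.id _) (fun i c => (s i).comp c) i, fun i => ?_, rfl⟩
    change (r i).comp ((s i).comp _) = _
    rw [← ContinuousMap.comp_assoc, hs, ContinuousMap.id_comp]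
  | succ j ih =>
    intro Y _ r hr
    obtain ⟨c, hc, hj⟩ := ih (fun i => Y (i + 1)) (fun i => r (i + 1)) fun i => hr (i + 1)
    -- The family for the sequence shifted by one is extended to index `0` by one more bonding map.
    refine ⟨fun i => Nat.casesOn i ((r 0).comp (c 0)) c, fun i => ?_, hj⟩
    cases i with
    | zero => rfl
    | succ i => exact hc i

variable {Y : ℕ → Type*} [∀ j, TopologicalSpace (Y j)] {r : ∀ j, C(Y (j + 1), Y j)}

namespace SequentialLimit

/-- The projection of an inverse limit to one of its terms. -/
def proj (r : ∀ j, C(Y (j + 1), Y j)) (j : ℕ) : C(SequentialLimit r, Y j) :=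
  ⟨fun y => y.1 j, (continuous_apply j).comp continuous_subtype_val⟩

theorem exists_section (hr : ∀ j, IsRetractionMap (r j)) (j : ℕ) :
    ∃ s : C(Y j, SequentialLimit r), ∀ z, proj r j (s z) = z := by
  obtain ⟨c, hc, hj⟩ := exists_compatible_sections j Y r hr
  refine ⟨⟨fun z => ⟨fun i => c i z, fun i => DFunLike.congr_fun (hc i) z⟩,
    Continuous.subtype_mk (by fun_prop) _⟩, fun z => ?_⟩
  exact DFunLike.congr_fun hj z

theorem proj_eq_of_le {y z : SequentialLimit r} {i j : ℕ} (hij : i ≤ j)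
    (h : proj r j y = proj r j z) : proj r i y = proj r i z := by
  induction j, hij using Nat.le_induction with
  | base => exact h
  | succ j _ ih =>
    refine ih ?_
    have := congrArg (r j) h
    exact (y.2 j).symm.trans (this.trans (z.2 j))

theorem compactSpace [∀ j, CompactSpace (Y j)] [∀ j, T2Space (Y j)] :
    CompactSpace (SequentialLimit r) := by
  have : IsClosed {y : ∀ j, Y j | ∀ j, r j (y (j + 1)) = y j} := by
    rw [Set.ofPred_forall]
    exact isClosed_iInter fun j => isClosed_eq (by fun_prop) (by fun_prop)
  exact isCompact_iff_compactSpace.1 this.isCompact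

/-- In a compact metric space that is an inverse limit, points with the same `j`-th coordinate
are close for large `j`. -/
theorem exists_dist_lt {X : Type*} [MetricSpace X] [CompactSpace X] [∀ j, T2Space (Y j)]
    (h : X ≃ₜ SequentialLimit r) {ε : ℝ} (hε : 0 < ε) :
    ∃ j, ∀ x y, proj r j (h x) = proj r j (h y) → dist x y < ε := by
  by_contra! hcon
  -- These sets are compact and decreasing; if all were nonempty, a common pair would have all
  -- coordinates equal and yet be at distance at least `ε`.
  let C : ℕ → Set (X × X) := fun j =>
    {p | proj r j (h p.1) = proj r j (h p.2) ∧ ε ≤ dist p.1 p.2}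
  have hcl : ∀ j, IsClosed (C j) := fun j =>
    IsClosed.inter
    (isClosed_eq ((proj r j).continuous.comp (h.continuous.comp continuous_fst))
      ((proj r j).continuous.comp (h.continuous.comp continuous_snd)))
    (isClosed_le continuous_const continuous_dist)
  obtain ⟨p, hp⟩ := IsCompact.nonempty_iInter_of_sequence_nonempty_isCompact_isClosed C
    (fun j p hp => ⟨proj_eq_of_le j.le_succ hp.1, hp.2⟩)
    (fun j => by
      obtain ⟨x, y, h1, h2⟩ := hcon j
      exact ⟨(x, y), h1, h2⟩) (hcl 0).isCompact hcl
  rw [Set.mem_iInter] at hp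
  have : p.1 = p.2 := h.injective (Subtype.ext (funext fun j => (hp j).1))
  have h2 := (hp 0).2
  rw [this, dist_self] at h2
  exact absurd hε (not_lt.2 h2)

end SequentialLimit

end Limits

/-! ### Comparison of the two topologies -/

/-- Each coordinate of the inverse limit takes values in a discrete set, so prescribing one
coordinate is an open condition. -/
theorem isOpen_setOf_shapeHom_eq (n : ℕ) {X : Type*} [TopologicalSpace X] [T4Space X] (x₀ : X)
    (a : π_ n X x₀) (𝒰 : PointedCover x₀) :
    IsOpen[shapeTopology n x₀] {b | (shapeHom n x₀ b).1 𝒰 = (shapeHom n x₀ a).1 𝒰} := by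
  let _ : ∀ 𝒱 : PointedCover x₀, TopologicalSpace (π_ n 𝒱.NerveSpace 𝒱.basepoint) := fun _ => ⊥
  refine ⟨{c | c.1 𝒰 = (shapeHom n x₀ a).1 𝒰}, ?_, rfl⟩
  have hc : Continuous fun c : ∀ 𝒱 : PointedCover x₀, π_ n 𝒱.NerveSpace 𝒱.basepoint => c 𝒰 :=
    continuous_apply 𝒰
  exact ⟨_, hc.isOpen_preimage {(shapeHom n x₀ a).1 𝒰} trivial, rfl⟩

/-- In Mathlib's order on topologies `t₁ ≤ t₂` means that `t₁` is at least as fine as `t₂`. -/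
theorem mainTheorem4 {X : Type*} [MetricSpace X] [PathConnectedSpace X]
    (Y : ℕ → Type*) [∀ j, TopologicalSpace (Y j)]
    (hY : ∀ j, IsFinitePolyhedron (Y j))
    (r : ∀ j, C(Y (j + 1), Y j)) (hr : ∀ j, IsRetractionMap (r j))
    (hX : Nonempty (X ≃ₜ SequentialLimit r))
    (n : ℕ) (hn : 1 ≤ n) (x₀ : X) :
    shapeTopology n x₀ ≤ pseudometricTopology n x₀ := by
  obtain ⟨h⟩ := hX
  have := fun j => (hY j).compactSpace
  have := fun j => (hY j).t2Space
  have : CompactSpace (SequentialLimit r) := SequentialLimit.compactSpace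
  have : CompactSpace X := h.symm.compactSpace
  intro A hA
  refine (@isOpen_iff_forall_mem_open _ (shapeTopology n x₀) _).2 fun a ha => ?_
  obtain ⟨ε, hε, hball⟩ := hA a ha
  -- Halving leaves room for the strict inequality, as the estimate for the infimum is only `≤`.
  obtain ⟨j, hj⟩ := SequentialLimit.exists_dist_lt h (half_pos hε)
  obtain ⟨s, hs⟩ := SequentialLimit.exists_section hr j
  let f : C(X, Y j) := (SequentialLimit.proj r j).comp (h : C(X, SequentialLimit r))
  let g : C(Y j, X) := (h.symm : C(SequentialLimit r, X)).comp s
  -- From `f ∘ g = id`, the points `g (f x)` and `x` have the same `j`-th coordinate, and `g ∘ f` is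
  -- idempotent.
  have hfg : ∀ z, f (g z) = z := fun z =>
    (congrArg (SequentialLimit.proj r j) (h.apply_symm_apply _)).trans (hs z)
  have he : ∀ x, dist (g.comp f x) x ≤ ε / 2 := fun x => (hj _ _ (hfg (f x))).le
  obtain ⟨𝒰, h𝒰⟩ := (hY j).exists_pointedCover f x₀
  refine ⟨_, fun b hb => hball b ?_, isOpen_setOf_shapeHom_eq n x₀ a 𝒰, rfl⟩
  induction a using Quotient.inductionOn with | h α => ?_
  induction b using Quotient.inductionOn with | h β => ?_
  have hαβ := h𝒰 _ n α β (Quotient.exact hb.symm)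
  exact (homotopyPseudodist_le_of_homotopic_comp hn (g.comp f) he (congrArg g (hfg (f x₀)))
    (PathConnectedSpace.somePath _ _)
    (ContinuousMap.HomotopicRel.comp_continuousMap hαβ g)).trans_lt (half_lt_self hε)
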